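/- Let $(M,g)$ be a smooth Lorentzian manifold of dimension $n\ge 3$ and signature $(-,+,\dots,+)$, carrying a smooth vector field $X$ (Chen's vector) with $X^2 := X^jX_j<0$ and $\nabla_jX_k=\rho\, g_{jk}$ for some scalar field $\rho$, where $\nabla$ is the Levi-Civita connection; that is, $(M,g)$ is a generalized Robertson–Walker (GRW) space-time. Let $R_{jklm}$ be the Riemann tensor, with the convention $\nabla_i\nabla_j\omega_k-\nabla_j\nabla_i\omega_k=R_{ijk}{}^m\omega_m$ for covector fields $\omega$; let $R_{kl}=R_{kml}{}^m$ be the Ricci tensor, $R=g^{kl}R_{kl}$ the curvature scalar, and $$C_{jklm}=R_{jklm}+\frac{1}{n-2}\left(g_{jm}R_{kl}-g_{km}R_{jl}+R_{jm}g_{kl}-R_{km}g_{jl}\right)-R\,\frac{g_{jm}g_{kl}-g_{jl}g_{km}}{(n-1)(n-2)}$$ the Weyl tensor. Suppose that the space-time is conformally flat in the sense that $C_{jklm}=0$ everywhere (a Robertson–Walker space-time). Then $X$ is an eigenvector of the Ricci tensor, $R_{jm}X^m=\xi X_j$ for a scalar function $\xi$ on $M$, and $$R_{jklm}=\frac{2\xi-R}{(n-1)(n-2)}\left(g_{kl}g_{jm}-g_{km}g_{jl}\right)+\frac{R-n\xi}{(n-1)(n-2)}\left[g_{jm}\frac{X_kX_l}{X^2}-g_{km}\frac{X_jX_l}{X^2}+g_{kl}\frac{X_jX_m}{X^2}-g_{jl}\frac{X_kX_m}{X^2}\right].$$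 -/

import Mathlib

open scoped Manifold ContDiff

noncomputable section

/-- A smooth Lorentzian metric, of signature `(-,+,…,+)`, on an `n`-dimensional smooth manifold. -/
structure LorentzMetric (n : ℕ) (M : Type*) [TopologicalSpace M]
    [ChartedSpace (EuclideanSpace ℝ (Fin n)) M] [IsManifold (𝓡 n) ∞ M] where
  /-- The bilinear form on each tangent space. -/
  val : ∀ x : M, TangentSpace (𝓡 n) x →L[ℝ] TangentSpace (𝓡 n) x →L[ℝ] ℝ
  symm : ∀ (x : M) (v w : TangentSpace (𝓡 n) x), val x v w = val x w v
  /-- There is a timelike vector whose orthogonal complement is positive definite. -/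
  lorentzian : ∀ x : M, ∃ v : TangentSpace (𝓡 n) x, val x v v < 0 ∧
    ∀ w : TangentSpace (𝓡 n) x, val x v w = 0 → w ≠ 0 → 0 < val x w w
  contMDiff : ContMDiff (𝓡 n)
    ((𝓡 n).prod 𝓘(ℝ, EuclideanSpace ℝ (Fin n) →L[ℝ] EuclideanSpace ℝ (Fin n) →L[ℝ] ℝ)) ∞
    (fun x : M => Bundle.TotalSpace.mk' (EuclideanSpace ℝ (Fin n) →L[ℝ] EuclideanSpace ℝ (Fin n) →L[ℝ] ℝ)
      (E := fun x : M => TangentSpace (𝓡 n) x →L[ℝ] TangentSpace (𝓡 n) x →L[ℝ] ℝ) x (val x))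

/-- The partial derivative `∂_i f` of a function of `n` real coordinates. -/
def partialD {n : ℕ} (i : Fin n) (f : EuclideanSpace ℝ (Fin n) → ℝ)
    (y : EuclideanSpace ℝ (Fin n)) : ℝ :=
  fderiv ℝ f y (EuclideanSpace.single i (1 : ℝ))

namespace LorentzMetric

variable {n : ℕ} {M : Type*} [TopologicalSpace M]
  [ChartedSpace (EuclideanSpace ℝ (Fin n)) M]

/-- The coordinate vector `∂_i` of the chart `e`, at the point `e.symm y` with coordinates `y`. -/
def coordVec (e : OpenPartialHomeomorph M (EuclideanSpace ℝ (Fin n)))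
    (y : EuclideanSpace ℝ (Fin n)) (i : Fin n) : TangentSpace (𝓡 n) (e.symm y) :=
  mfderiv (𝓡 n) (𝓡 n) e.symm y (EuclideanSpace.single i (1 : ℝ))

variable [IsManifold (𝓡 n) ∞ M] (g : LorentzMetric n M)
  (e : OpenPartialHomeomorph M (EuclideanSpace ℝ (Fin n)))

/-- The components `g_{ij}` of the metric in the chart `e`. -/
def gLow (y : EuclideanSpace ℝ (Fin n)) : Matrix (Fin n) (Fin n) ℝ :=
  Matrix.of fun i j => g.val (e.symm y) (coordVec e y i) (coordVec e y j)

/-- The components `g^{ij}` of the inverse metric in the chart `e`. -/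
def gUp (y : EuclideanSpace ℝ (Fin n)) : Matrix (Fin n) (Fin n) ℝ := (g.gLow e y)⁻¹

/-- The covariant components `X_k = g(X, ∂_k)` of a vector field. -/
def vecLow (X : ∀ x : M, TangentSpace (𝓡 n) x) (y : EuclideanSpace ℝ (Fin n)) (k : Fin n) : ℝ :=
  g.val (e.symm y) (X (e.symm y)) (coordVec e y k)

/-- The contravariant components `X^k = g^{kl} X_l` of a vector field. -/
def vecUp (X : ∀ x : M, TangentSpace (𝓡 n) x) (y : EuclideanSpace ℝ (Fin n)) (k : Fin n) : ℝ :=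
  ∑ l, g.gUp e y k l * g.vecLow e X y l

/-- `X² = g(X, X)`. -/
def normSq (X : ∀ x : M, TangentSpace (𝓡 n) x) (x : M) : ℝ := g.val x (X x) (X x)

/-- The Christoffel symbols `Γ^k_{ij}` of the Levi-Civita connection; `christoffel y k i j`. -/
def christoffel (y : EuclideanSpace ℝ (Fin n)) (k i j : Fin n) : ℝ :=
  (1 / 2) * ∑ l, g.gUp e y k l *
    (partialD i (fun z => g.gLow e z j l) y + partialD j (fun z => g.gLow e z i l) y
      - partialD l (fun z => g.gLow e z i j) y)

/-- `∇_j X_k = ∂_j X_k - Γ^m_{jk} X_m`. -/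
def nablaLow (X : ∀ x : M, TangentSpace (𝓡 n) x) (y : EuclideanSpace ℝ (Fin n))
    (j k : Fin n) : ℝ :=
  partialD j (fun z => g.vecLow e X z k) y - ∑ m, g.christoffel e y m j k * g.vecLow e X y m

/-- The curvature `R_{ijk}{}^m`, with the convention
`∇_i ∇_j ω_k - ∇_j ∇_i ω_k = R_{ijk}{}^m ω_m`. -/
def riemannUp (y : EuclideanSpace ℝ (Fin n)) (i j k m : Fin n) : ℝ :=
  partialD j (fun z => g.christoffel e z m i k) y - partialD i (fun z => g.christoffel e z m j k) y
    + ∑ p, (g.christoffel e y p i k * g.christoffel e y m j p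
      - g.christoffel e y p j k * g.christoffel e y m i p)

/-- The Riemann tensor `R_{ijkl} = R_{ijk}{}^m g_{ml}`. -/
def riemann (y : EuclideanSpace ℝ (Fin n)) (i j k l : Fin n) : ℝ :=
  ∑ m, g.riemannUp e y i j k m * g.gLow e y m l

/-- The Ricci tensor `R_{kl} = R_{kml}{}^m`, positive on round spheres. -/
def ricci (y : EuclideanSpace ℝ (Fin n)) (k l : Fin n) : ℝ :=
  ∑ m, g.riemannUp e y k m l m

/-- The curvature scalar `R = g^{kl} R_{kl}`. -/
def scalar (y : EuclideanSpace ℝ (Fin n)) : ℝ :=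
  ∑ k, ∑ l, g.gUp e y k l * g.ricci e y k l

/-- The Weyl tensor `C_{jklm}` (for `n ≥ 3`). -/
def weyl (y : EuclideanSpace ℝ (Fin n)) (j k l m : Fin n) : ℝ :=
  g.riemann e y j k l m
    + 1 / ((n : ℝ) - 2) *
      (g.gLow e y j m * g.ricci e y k l - g.gLow e y k m * g.ricci e y j l
        + g.ricci e y j m * g.gLow e y k l - g.ricci e y k m * g.gLow e y j l)
    - g.scalar e y * (g.gLow e y j m * g.gLow e y k l - g.gLow e y j l * g.gLow e y k m)
      / (((n : ℝ) - 1) * ((n : ℝ) - 2))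

/-- `X` is a Chen vector: a smooth timelike vector field with `∇_j X_k = ρ g_{jk}` for some scalar
field `ρ`. A Lorentzian manifold of dimension at least three is a generalized Robertson-Walker
space-time if it carries such a field. -/
structure IsChenVector (X : ∀ x : M, TangentSpace (𝓡 n) x) : Prop where
  contMDiff : ContMDiff (𝓡 n) (𝓡 n).tangent ∞
    (fun x : M => (⟨x, X x⟩ : TangentBundle (𝓡 n) M))
  timelike : ∀ x : M, g.normSq X x < 0
  concircular : ∃ ρ : M → ℝ, ∀ e ∈ IsManifold.maximalAtlas (𝓡 n) ∞ M, ∀ y ∈ e.target,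
    ∀ j k : Fin n, g.nablaLow e X y j k = ρ (e.symm y) * g.gLow e y j k

/-- Conformal flatness in the sense of a vanishing Weyl tensor. -/
def WeylFlat : Prop :=
  ∀ e ∈ IsManifold.maximalAtlas (𝓡 n) ∞ M, ∀ y ∈ e.target,
    ∀ j k l m : Fin n, g.weyl e y j k l m = 0

end LorentzMetric

end

/-! Write `a = dρ`. The Ricci identity applied to `∇_j X_k = ρ g_{jk}` gives `R_{ijk}{}^m X_m = a_i
g_{jk} - a_j g_{ik}` (`sum_riemannUp_mul_vecLow`), after which everything is pointwise linear
algebra.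

When the Weyl tensor vanishes, `R_{jklm}` is antisymmetric in `l, m`. Contracting both slots with
`X` then forces `a` to be parallel to `X`, say `a = β X` with `β = dρ(X) / X²`, because `X² ≠ 0`.
Tracing the same identity gives `R_{kl} X^l = -(n-1) a_k`, so `X` is a Ricci eigenvector with `ξ =
-(n-1) β`.

Contracting `C_{jklm} = 0` with `X^m X^j` leaves an equation solvable for the Ricci tensor, which is
therefore a combination of `g_{kl}` and `X_k X_l / X²` (`ricci_eq_of_riemannUp`). Substituting this
back into `C_{jklm} = 0` yields the Riemann tensor. -/

section partialD

variable {n : ℕ} {f h : EuclideanSpace ℝ (Fin n) → ℝ} {y : EuclideanSpace ℝ (Fin n)}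

theorem partialD_congr_of_eventuallyEq (hfh : f =ᶠ[nhds y] h) (i : Fin n) :
    partialD i f y = partialD i h y := by
  rw [partialD, partialD, hfh.fderiv_eq]

theorem partialD_add (hf : DifferentiableAt ℝ f y) (hh : DifferentiableAt ℝ h y) (i : Fin n) :
    partialD i (fun z => f z + h z) y = partialD i f y + partialD i h y := by
  simp [partialD, fderiv_fun_add hf hh]

theorem partialD_mul (hf : DifferentiableAt ℝ f y) (hh : DifferentiableAt ℝ h y) (i : Fin n) :
    partialD i (fun z => f z * h z) y = partialD i f y * h y + f y * partialD i h y := by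
  simp [partialD, fderiv_fun_mul hf hh]
  ring

theorem partialD_sum {ι : Type*} {s : Finset ι} {f : ι → EuclideanSpace ℝ (Fin n) → ℝ}
    (hf : ∀ a ∈ s, DifferentiableAt ℝ (f a) y) (i : Fin n) :
    partialD i (fun z => ∑ a ∈ s, f a z) y = ∑ a ∈ s, partialD i (f a) y := by
  simp [partialD, fderiv_fun_sum hf]

theorem partialD_comm (hf : ContDiffAt ℝ 2 f y) (i j : Fin n) :
    partialD i (partialD j f) y = partialD j (partialD i f) y := by
  have hd : DifferentiableAt ℝ (fderiv ℝ f) y :=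
    (hf.fderiv_right (m := 1) (by norm_num)).differentiableAt (by simp)
  have key : ∀ i j : Fin n, partialD i (partialD j f) y =
      fderiv ℝ (fderiv ℝ f) y (EuclideanSpace.single i (1 : ℝ))
        (EuclideanSpace.single j (1 : ℝ)) := by
    intro i j
    unfold partialD
    rw [fderiv_clm_apply hd (differentiableAt_const _)]
    simp
  rw [key, key]
  exact hf.isSymmSndFDerivAt (by simp) _ _

theorem contDiffOn_partialD {s : Set (EuclideanSpace ℝ (Fin n))} (hs : IsOpen s)
    (hf : ContDiffOn ℝ ∞ f s) (i : Fin n) :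
    ContDiffOn ℝ ∞ (partialD i f) s :=
  (hf.fderiv_of_isOpen hs (by simp)).clm_apply contDiffOn_const

end partialD

/-! ### Coordinate frames of a chart. -/

namespace LorentzMetric

variable {n : ℕ} {M : Type*} [TopologicalSpace M]
  [ChartedSpace (EuclideanSpace ℝ (Fin n)) M]
  {e : OpenPartialHomeomorph M (EuclideanSpace ℝ (Fin n))}

theorem exists_eq_sum_coordVec (he : e ∈ IsManifold.maximalAtlas (𝓡 n) ∞ M)
    {y : EuclideanSpace ℝ (Fin n)} (hy : y ∈ e.target) (v : TangentSpace (𝓡 n) (e.symm y)) :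
    ∃ c : Fin n → ℝ, v = ∑ i, c i • coordVec e y i := by
  have hm : e.MDifferentiable (𝓡 n) (𝓡 n) :=
    ⟨(contMDiffOn_of_mem_maximalAtlas he).mdifferentiableOn (by simp),
      (contMDiffOn_symm_of_mem_maximalAtlas he).mdifferentiableOn (by simp)⟩
  obtain ⟨u, rfl⟩ := hm.symm.mfderiv_surjective hy v
  let u' : EuclideanSpace ℝ (Fin n) := u
  refine ⟨fun i => u' i, ?_⟩
  have : u = ∑ i, u' i • (EuclideanSpace.single i (1 : ℝ)) := by
    change u' = _
    ext j
    simp [Pi.single_apply]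
  conv_lhs => rw [this]
  erw [map_sum]
  refine Finset.sum_congr rfl fun i _ => ?_
  exact map_smul _ _ _

theorem sum_smul_coordVec_eq_zero (he : e ∈ IsManifold.maximalAtlas (𝓡 n) ∞ M)
    {y : EuclideanSpace ℝ (Fin n)} (hy : y ∈ e.target) {c : Fin n → ℝ}
    (hc : ∑ i, c i • coordVec e y i = 0) : c = 0 := by
  have hm : e.MDifferentiable (𝓡 n) (𝓡 n) :=
    ⟨(contMDiffOn_of_mem_maximalAtlas he).mdifferentiableOn (by simp),
      (contMDiffOn_symm_of_mem_maximalAtlas he).mdifferentiableOn (by simp)⟩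
  have h : mfderiv (𝓡 n) (𝓡 n) e.symm y (∑ i, c i • (EuclideanSpace.single i (1 : ℝ))) = 0 := by
    rw [← hc]
    erw [map_sum]
    refine Finset.sum_congr rfl fun i _ => ?_
    exact map_smul _ _ _
  have h2 : (∑ i, c i • (EuclideanSpace.single i (1 : ℝ)) : EuclideanSpace ℝ (Fin n)) = 0 :=
    hm.symm.mfderiv_injective hy (h.trans (map_zero _).symm)
  ext j
  have := congrArg (fun w : EuclideanSpace ℝ (Fin n) => w j) h2
  simpa [Pi.single_apply] using this

/-- Chain rule along the chart. It identifies `X^k ∂_k ρ` with the chart-independent `dρ(X)`, so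
that `ξ` can be a single function on `M`. -/
theorem partialD_comp_symm (he : e ∈ IsManifold.maximalAtlas (𝓡 n) ∞ M)
    {y : EuclideanSpace ℝ (Fin n)} (hy : y ∈ e.target) {ρ : M → ℝ}
    (hρ : DifferentiableAt ℝ (fun z => ρ (e.symm z)) y) (k : Fin n) :
    partialD k (fun z => ρ (e.symm z)) y =
      mfderiv (𝓡 n) 𝓘(ℝ, ℝ) ρ (e.symm y) (coordVec e y k) := by
  have h1 : MDifferentiableAt (𝓡 n) (𝓡 n) e.symm y :=
    (contMDiffAt_symm_of_mem_maximalAtlas he hy).mdifferentiableAt (by simp)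
  have h2 : MDifferentiableAt (𝓡 n) (𝓡 n) e (e.symm y) :=
    (contMDiffAt_of_mem_maximalAtlas he (e.map_target hy)).mdifferentiableAt (by simp)
  have h3 : MDifferentiableAt (𝓡 n) 𝓘(ℝ, ℝ) ρ (e.symm y) := by
    have h4 : MDifferentiableAt (𝓡 n) 𝓘(ℝ, ℝ) (fun z => ρ (e.symm z)) (e (e.symm y)) := by
      rw [e.right_inv hy]; exact hρ.mdifferentiableAt
    refine (h4.comp (e.symm y) h2).congr_of_eventuallyEq ?_
    filter_upwards [e.open_source.mem_nhds (e.map_target hy)] with x hx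
    simp [e.left_inv hx]
  have h5 := mfderiv_comp y h3 h1
  unfold partialD coordVec
  rw [← mfderiv_eq_fderiv]
  exact congrArg (fun L => L (EuclideanSpace.single k (1 : ℝ))) h5

variable [IsManifold (𝓡 n) ∞ M]

/-- The coordinate vector fields of a smooth chart are smooth. -/
theorem contMDiffOn_coordVec (he : e ∈ IsManifold.maximalAtlas (𝓡 n) ∞ M) (i : Fin n) :
    ContMDiffOn (𝓡 n) (𝓡 n).tangent ∞
      (fun y => (⟨e.symm y, coordVec e y i⟩ : TangentBundle (𝓡 n) M)) e.target := by
  have h1 := contMDiffOn_symm_of_mem_maximalAtlas he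
  have h2 := h1.contMDiffOn_tangentMapWithin (m := ∞) (by simp) e.open_target.uniqueMDiffOn
  have h3 : ContMDiff (𝓡 n) (𝓡 n).tangent ∞
      (fun y : EuclideanSpace ℝ (Fin n) =>
        (⟨y, EuclideanSpace.single i (1 : ℝ)⟩ :
          TangentBundle (𝓡 n) (EuclideanSpace ℝ (Fin n)))) := by
    exact contMDiff_vectorSpace_iff_contDiff.mpr contDiff_const
  have h4 := h2.comp (h3.contMDiffOn (s := e.target)) (fun y hy => hy)
  refine h4.congr fun y hy => ?_
  simp [tangentMapWithin, coordVec, mfderivWithin_of_isOpen e.open_target hy]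

/-! ### The metric, its inverse and the Christoffel symbols in a chart. -/

variable (g : LorentzMetric n M)

theorem contDiffOn_metric_apply (he : e ∈ IsManifold.maximalAtlas (𝓡 n) ∞ M)
    {Y Z : ∀ y : EuclideanSpace ℝ (Fin n), TangentSpace (𝓡 n) (e.symm y)}
    (hY : ContMDiffOn (𝓡 n) (𝓡 n).tangent ∞
      (fun y => (⟨e.symm y, Y y⟩ : TangentBundle (𝓡 n) M)) e.target)
    (hZ : ContMDiffOn (𝓡 n) (𝓡 n).tangent ∞
      (fun y => (⟨e.symm y, Z y⟩ : TangentBundle (𝓡 n) M)) e.target) :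
    ContDiffOn ℝ ∞ (fun y => g.val (e.symm y) (Y y) (Z y)) e.target := by
  have h1 := contMDiffOn_symm_of_mem_maximalAtlas he
  rw [← contMDiffOn_iff_contDiffOn]
  intro y hy
  have h2 := g.contMDiff.contMDiffOn.comp h1 (Set.subset_preimage_univ) y hy
  have : ContMDiffWithinAt (𝓡 n) ((𝓡 n).prod 𝓘(ℝ, ℝ)) ∞
    (fun y => Bundle.TotalSpace.mk' ℝ (E := Bundle.Trivial M ℝ) (e.symm y)
      (g.val (e.symm y) (Y y) (Z y)))
      e.target y :=
    ContMDiffWithinAt.clm_bundle_apply₂ (F₁ := EuclideanSpace ℝ (Fin n))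
      (F₂ := EuclideanSpace ℝ (Fin n)) h2 (hY y hy) (hZ y hy)
  rw [Bundle.contMDiffWithinAt_totalSpace] at this
  exact this.2

theorem contDiffOn_gLow (he : e ∈ IsManifold.maximalAtlas (𝓡 n) ∞ M) (i j : Fin n) :
    ContDiffOn ℝ ∞ (fun y => g.gLow e y i j) e.target :=
  g.contDiffOn_metric_apply he (contMDiffOn_coordVec he i) (contMDiffOn_coordVec he j)

theorem contDiffOn_vecLow (he : e ∈ IsManifold.maximalAtlas (𝓡 n) ∞ M)
    {X : ∀ x : M, TangentSpace (𝓡 n) x} (hX : ContMDiff (𝓡 n) (𝓡 n).tangent ∞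
      (fun x : M => (⟨x, X x⟩ : TangentBundle (𝓡 n) M))) (k : Fin n) :
    ContDiffOn ℝ ∞ (fun y => g.vecLow e X y k) e.target :=
  g.contDiffOn_metric_apply he
    (hX.comp_contMDiffOn (contMDiffOn_symm_of_mem_maximalAtlas he)) (contMDiffOn_coordVec he k)

theorem gLow_symm (y : EuclideanSpace ℝ (Fin n)) (i j : Fin n) :
    g.gLow e y i j = g.gLow e y j i := g.symm _ _ _

/-- A Lorentzian metric is nondegenerate. -/
theorem isUnit_det_gLow (he : e ∈ IsManifold.maximalAtlas (𝓡 n) ∞ M)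
    {y : EuclideanSpace ℝ (Fin n)} (hy : y ∈ e.target) : IsUnit (g.gLow e y).det := by
  rw [isUnit_iff_ne_zero]
  intro h0
  obtain ⟨c, hc, hc0⟩ := Matrix.exists_vecMul_eq_zero_iff.mpr h0
  apply hc
  apply sum_smul_coordVec_eq_zero he hy
  have hperp : ∀ v, g.val (e.symm y) (∑ i, c i • coordVec e y i) v = 0 := by
    intro v
    obtain ⟨d, rfl⟩ := exists_eq_sum_coordVec he hy v
    rw [map_sum]
    refine Finset.sum_eq_zero fun j _ => ?_
    have := congrFun hc0 j
    simp only [Matrix.vecMul, dotProduct, Pi.zero_apply] at this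
    rw [map_smul, map_sum]
    simp only [sum_apply, map_smul, smul_apply, smul_eq_mul]
    erw [this, mul_zero]
  by_contra hw
  -- A nonzero kernel vector `w` is orthogonal to the timelike `v`, hence `g(w, w) > 0`; but it is
  -- also orthogonal to itself.
  obtain ⟨v, -, hv⟩ := g.lorentzian (e.symm y)
  exact absurd (hv _ (by rw [g.symm, hperp]) hw) (by rw [hperp]; exact lt_irrefl _)

theorem sum_gLow_mul_gUp (he : e ∈ IsManifold.maximalAtlas (𝓡 n) ∞ M)
    {y : EuclideanSpace ℝ (Fin n)} (hy : y ∈ e.target) (i j : Fin n) :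
    ∑ k, g.gLow e y i k * g.gUp e y k j = if i = j then 1 else 0 := by
  rw [← Matrix.mul_apply, gUp, Matrix.mul_nonsing_inv _ (g.isUnit_det_gLow he hy), Matrix.one_apply]

theorem gUp_symm (y : EuclideanSpace ℝ (Fin n)) (i j : Fin n) :
    g.gUp e y i j = g.gUp e y j i := by
  have h : (g.gLow e y).transpose = g.gLow e y := by
    ext i j; exact g.gLow_symm y j i
  have := congrFun₂ (Matrix.transpose_nonsing_inv (g.gLow e y)) j i
  rw [h] at this
  exact this

/-- Cramer's rule: each entry of the inverse is a quotient of determinants with smooth entries and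
nonvanishing denominator. -/
theorem contDiffOn_gUp (he : e ∈ IsManifold.maximalAtlas (𝓡 n) ∞ M) (i j : Fin n) :
    ContDiffOn ℝ ∞ (fun y => g.gUp e y i j) e.target := by
  have hdet : ∀ A : EuclideanSpace ℝ (Fin n) → Matrix (Fin n) (Fin n) ℝ,
      (∀ i j, ContDiffOn ℝ ∞ (fun y => A y i j) e.target) →
      ContDiffOn ℝ ∞ (fun y => (A y).det) e.target := by
    intro A hA
    simp only [Matrix.det_apply]
    refine ContDiffOn.sum fun σ _ => ?_
    refine ContDiffOn.const_smul _ ?_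
    exact contDiffOn_prod fun k _ => hA _ _
  have h : ∀ y ∈ e.target, g.gUp e y i j = (g.gLow e y).det⁻¹ *
      ((g.gLow e y).updateRow j (Pi.single i 1)).det := by
    intro y hy
    simp [gUp, Matrix.inv_def, Matrix.adjugate_apply]
  refine ContDiffOn.congr (ContDiffOn.mul (ContDiffOn.inv (hdet _ (g.contDiffOn_gLow he))
    fun y hy => (g.isUnit_det_gLow he hy).ne_zero) (hdet _ fun k l => ?_)) h
  by_cases hk : k = j
  · subst hk
    simpa using contDiffOn_const
  · simpa [Matrix.updateRow_ne hk] using g.contDiffOn_gLow he k l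

theorem contDiffOn_christoffel (he : e ∈ IsManifold.maximalAtlas (𝓡 n) ∞ M) (k i j : Fin n) :
    ContDiffOn ℝ ∞ (fun y => g.christoffel e y k i j) e.target := by
  unfold christoffel
  have h := fun i j k => contDiffOn_partialD e.open_target (g.contDiffOn_gLow he i j) k
  exact contDiffOn_const.mul (ContDiffOn.sum fun l _ =>
    (g.contDiffOn_gUp he k l).mul (((h _ _ _).add (h _ _ _)).sub (h _ _ _)))

theorem christoffel_symm (y : EuclideanSpace ℝ (Fin n)) (k i j : Fin n) :
    g.christoffel e y k i j = g.christoffel e y k j i := by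
  unfold christoffel
  have h : (fun z => g.gLow e z i j) = fun z => g.gLow e z j i := funext fun z => g.gLow_symm z i j
  simp only [h]
  congr 1
  exact Finset.sum_congr rfl fun l _ => by ring

theorem vecLow_eq_sum (X : ∀ x : M, TangentSpace (𝓡 n) x) (y : EuclideanSpace ℝ (Fin n))
    {c : Fin n → ℝ} (hc : X (e.symm y) = ∑ i, c i • coordVec e y i) (k : Fin n) :
    g.vecLow e X y k = ∑ i, g.gLow e y k i * c i := by
  simp only [vecLow, hc, map_sum, map_smul, sum_apply,
    smul_apply, smul_eq_mul]
  exact Finset.sum_congr rfl fun i _ => by rw [g.gLow_symm, mul_comm]; rfl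

theorem eq_sum_vecUp_smul_coordVec (he : e ∈ IsManifold.maximalAtlas (𝓡 n) ∞ M)
    {y : EuclideanSpace ℝ (Fin n)} (hy : y ∈ e.target) (X : ∀ x : M, TangentSpace (𝓡 n) x) :
    X (e.symm y) = ∑ i, g.vecUp e X y i • coordVec e y i := by
  obtain ⟨c, hc⟩ := exists_eq_sum_coordVec he hy (X (e.symm y))
  have h : g.vecUp e X y = c := by
    have h1 : g.vecLow e X y = (g.gLow e y).mulVec c := funext fun k => g.vecLow_eq_sum X y hc k
    have h2 : g.vecUp e X y = (g.gUp e y).mulVec (g.vecLow e X y) := rfl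
    rw [h2, h1, Matrix.mulVec_mulVec, gUp, Matrix.nonsing_inv_mul _ (g.isUnit_det_gLow he hy),
      Matrix.one_mulVec]
  rw [h]
  exact hc

theorem normSq_eq_sum (he : e ∈ IsManifold.maximalAtlas (𝓡 n) ∞ M)
    {y : EuclideanSpace ℝ (Fin n)} (hy : y ∈ e.target) (X : ∀ x : M, TangentSpace (𝓡 n) x) :
    ∑ i, g.vecUp e X y i * g.vecLow e X y i = g.normSq X (e.symm y) := by
  have h : g.normSq X (e.symm y) =
      g.val (e.symm y) (X (e.symm y)) (∑ i, g.vecUp e X y i • coordVec e y i) := by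
    rw [← g.eq_sum_vecUp_smul_coordVec he hy X]; rfl
  rw [h, map_sum]
  exact Finset.sum_congr rfl fun i _ => by rw [map_smul]; rfl

/-- The Christoffel symbols of the first kind. -/
theorem sum_christoffel_mul_gLow (he : e ∈ IsManifold.maximalAtlas (𝓡 n) ∞ M)
    {y : EuclideanSpace ℝ (Fin n)} (hy : y ∈ e.target) (i j k : Fin n) :
    ∑ m, g.christoffel e y m i j * g.gLow e y m k =
      (1 / 2) * (partialD i (fun z => g.gLow e z j k) y + partialD j (fun z => g.gLow e z i k) y
        - partialD k (fun z => g.gLow e z i j) y) := by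
  set F : Fin n → ℝ := fun l => partialD i (fun z => g.gLow e z j l) y +
    partialD j (fun z => g.gLow e z i l) y - partialD l (fun z => g.gLow e z i j) y
  calc ∑ m, g.christoffel e y m i j * g.gLow e y m k
      = ∑ m, ∑ l, (1 / 2) * F l * (g.gLow e y k m * g.gUp e y m l) := by
        refine Finset.sum_congr rfl fun m _ => ?_
        rw [christoffel, Finset.mul_sum, Finset.sum_mul]
        refine Finset.sum_congr rfl fun l _ => ?_
        rw [g.gLow_symm y m k]; ring
    _ = (1 / 2) * F k := by
        rw [Finset.sum_comm]
        simp_rw [← Finset.mul_sum, g.sum_gLow_mul_gUp he hy]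
        simp

/-! ### The Ricci identity for a concircular field. -/

/-- The factor `ρ` in `∇_j X_k = ρ g_{jk}` is smooth. -/
theorem contDiffOn_of_nablaLow_eq (hn : n ≠ 0) (he : e ∈ IsManifold.maximalAtlas (𝓡 n) ∞ M)
    {X : ∀ x : M, TangentSpace (𝓡 n) x} (hX : ContMDiff (𝓡 n) (𝓡 n).tangent ∞
      (fun x : M => (⟨x, X x⟩ : TangentBundle (𝓡 n) M))) {ρ : M → ℝ}
    (hρ : ∀ y ∈ e.target, ∀ j k, g.nablaLow e X y j k = ρ (e.symm y) * g.gLow e y j k) :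
    ContDiffOn ℝ ∞ (fun y => ρ (e.symm y)) e.target := by
  -- Nothing is assumed about the regularity of `ρ`; it is recovered as the trace `g^{kj} ∇_j X_k /
  -- n`, which is visibly smooth.
  have h : ContDiffOn ℝ ∞ (fun y => (n : ℝ)⁻¹ * ∑ j, ∑ k, g.nablaLow e X y j k * g.gUp e y k j)
      e.target := by
    refine contDiffOn_const.mul (ContDiffOn.sum fun j _ => ContDiffOn.sum fun k _ =>
      ContDiffOn.mul ?_ (g.contDiffOn_gUp he k j))
    exact (contDiffOn_partialD e.open_target (g.contDiffOn_vecLow he hX k) j).sub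
      (ContDiffOn.sum fun m _ => (g.contDiffOn_christoffel he m j k).mul
        (g.contDiffOn_vecLow he hX m))
  refine h.congr fun y hy => ?_
  simp_rw [hρ y hy, mul_assoc, ← Finset.mul_sum, g.sum_gLow_mul_gUp he hy]
  have : (n : ℝ) ≠ 0 := by exact_mod_cast hn
  simp
  field_simp

/-- The Ricci identity for a concircular field: `R_{ijk}{}^m X_m = g_{jk} ∂_i ρ - g_{ik} ∂_j ρ`. -/
theorem sum_riemannUp_mul_vecLow (hn : n ≠ 0) (he : e ∈ IsManifold.maximalAtlas (𝓡 n) ∞ M)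
    {X : ∀ x : M, TangentSpace (𝓡 n) x} (hX : ContMDiff (𝓡 n) (𝓡 n).tangent ∞
      (fun x : M => (⟨x, X x⟩ : TangentBundle (𝓡 n) M))) {ρ : M → ℝ}
    (hρ : ∀ y ∈ e.target, ∀ j k, g.nablaLow e X y j k = ρ (e.symm y) * g.gLow e y j k)
    {y : EuclideanSpace ℝ (Fin n)} (hy : y ∈ e.target) (i j k : Fin n) :
    ∑ m, g.riemannUp e y i j k m * g.vecLow e X y m =
      partialD i (fun z => ρ (e.symm z)) y * g.gLow e y j k
        - partialD j (fun z => ρ (e.symm z)) y * g.gLow e y i k := by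
  have hmem : e.target ∈ nhds y := e.open_target.mem_nhds hy
  have hdiff : ∀ {f : EuclideanSpace ℝ (Fin n) → ℝ}, ContDiffOn ℝ ∞ f e.target →
      DifferentiableAt ℝ f y := fun hf => (hf.contDiffAt hmem).differentiableAt (by simp)
  have hXd := fun k => hdiff (g.contDiffOn_vecLow he hX k)
  have hΓd := fun k i j => hdiff (g.contDiffOn_christoffel he k i j)
  have hgd := fun i j => hdiff (g.contDiffOn_gLow he i j)
  have hρd := hdiff (g.contDiffOn_of_nablaLow_eq hn he hX hρ)
  have hfirst : ∀ z ∈ e.target, ∀ j k, partialD j (fun z => g.vecLow e X z k) z =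
      ∑ m, g.christoffel e z m j k * g.vecLow e X z m + ρ (e.symm z) * g.gLow e z j k := by
    intro z hz j k
    have := hρ z hz j k
    rw [nablaLow] at this
    linarith
  have hsecond : ∀ i j k, partialD i (partialD j (fun z => g.vecLow e X z k)) y =
      ∑ m, (partialD i (fun z => g.christoffel e z m j k) y * g.vecLow e X y m +
        g.christoffel e y m j k * partialD i (fun z => g.vecLow e X z m) y) +
      (partialD i (fun z => ρ (e.symm z)) y * g.gLow e y j k +
        ρ (e.symm y) * partialD i (fun z => g.gLow e z j k) y) := by
    intro i j k
    have hev : partialD j (fun z => g.vecLow e X z k) =ᶠ[nhds y] fun z =>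
        ∑ m, g.christoffel e z m j k * g.vecLow e X z m + ρ (e.symm z) * g.gLow e z j k :=
      Filter.eventually_of_mem hmem fun z hz => hfirst z hz j k
    rw [partialD_congr_of_eventuallyEq hev, partialD_add
      (DifferentiableAt.fun_sum fun m _ => (hΓd m j k).fun_mul (hXd m)) (hρd.fun_mul (hgd j k)),
      partialD_sum fun m _ => (hΓd m j k).fun_mul (hXd m), partialD_mul hρd (hgd j k)]
    simp_rw [partialD_mul (hΓd _ j k) (hXd _)]
  have hcomm := partialD_comm (((g.contDiffOn_vecLow he hX k).contDiffAt hmem).of_le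
    (WithTop.coe_le_coe.mpr (le_top : (2 : ℕ∞) ≤ ⊤))) i j
  rw [hsecond, hsecond] at hcomm
  simp_rw [hfirst y hy, mul_add, Finset.sum_add_distrib] at hcomm
  have hq : ∀ i j, ∑ m, g.christoffel e y m j k * ∑ p, g.christoffel e y p i m * g.vecLow e X y p =
      ∑ m, (∑ p, g.christoffel e y p j k * g.christoffel e y m i p) * g.vecLow e X y m := by
    intro i j
    simp_rw [Finset.mul_sum, Finset.sum_mul]
    rw [Finset.sum_comm]
    exact Finset.sum_congr rfl fun _ _ => Finset.sum_congr rfl fun _ _ => by ring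
  -- Together with `ρ ∂_i g_{jk}` this makes `(ρ/2)(∂_i g_{jk} + ∂_j g_{ki} + ∂_k g_{ij})`,
  -- symmetric in `i, j`, so all undifferentiated `ρ` terms cancel in the commutator.
  have hr : ∀ i j, ∑ m, g.christoffel e y m j k * (ρ (e.symm y) * g.gLow e y i m) =
      ρ (e.symm y) * ((1 / 2) * (partialD j (fun z => g.gLow e z k i) y +
        partialD k (fun z => g.gLow e z j i) y - partialD i (fun z => g.gLow e z j k) y)) := by
    intro i j
    rw [← g.sum_christoffel_mul_gLow he hy, Finset.mul_sum]
    exact Finset.sum_congr rfl fun m _ => by rw [g.gLow_symm y i m]; ring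
  rw [hq, hq, hr, hr] at hcomm
  have hsymm : ∀ i j, (fun z => g.gLow e z i j) = fun z => g.gLow e z j i :=
    fun i j => funext fun z => g.gLow_symm z i j
  rw [hsymm k i, hsymm k j, hsymm j i] at hcomm
  simp_rw [riemannUp, add_mul, sub_mul, Finset.sum_sub_distrib, sub_mul, Finset.sum_add_distrib,
    Finset.sum_sub_distrib]
  linarith


/-! ### Symmetries of the curvature when the Weyl tensor vanishes. -/

variable {n : ℕ} {M : Type*} [TopologicalSpace M]
  [ChartedSpace (EuclideanSpace ℝ (Fin n)) M] [IsManifold (𝓡 n) ∞ M]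
  {e : OpenPartialHomeomorph M (EuclideanSpace ℝ (Fin n))} (g : LorentzMetric n M)

/-- The Ricci and scalar terms of the Weyl tensor are already antisymmetric in the last pair, so `C
= 0` passes this on to the Riemann tensor without using metric compatibility. -/
theorem riemann_antisymm_of_weyl_eq_zero {y : EuclideanSpace ℝ (Fin n)}
    (hW : ∀ j k l m, g.weyl e y j k l m = 0) (j k l m : Fin n) :
    g.riemann e y j k l m = -g.riemann e y j k m l := by
  have h1 := hW j k l m
  have h2 := hW j k m l
  unfold weyl at h1 h2
  linear_combination h1 + h2

theorem riemannUp_eq_sum (he : e ∈ IsManifold.maximalAtlas (𝓡 n) ∞ M)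
    {y : EuclideanSpace ℝ (Fin n)} (hy : y ∈ e.target) (i j k m : Fin n) :
    g.riemannUp e y i j k m = ∑ p, g.riemann e y i j k p * g.gUp e y p m := by
  simp_rw [riemann, Finset.sum_mul]
  rw [Finset.sum_comm]
  simp_rw [mul_assoc, ← Finset.mul_sum, g.sum_gLow_mul_gUp he hy]
  simp

/-- The first Bianchi identity. -/
theorem riemannUp_bianchi (y : EuclideanSpace ℝ (Fin n)) (i j k m : Fin n) :
    g.riemannUp e y i j k m + g.riemannUp e y j k i m + g.riemannUp e y k i j m = 0 := by
  have h : ∀ k i j, (fun z => g.christoffel e z k i j) = fun z => g.christoffel e z k j i :=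
    fun k i j => funext fun z => g.christoffel_symm z k i j
  simp only [riemannUp, Finset.sum_sub_distrib]
  rw [h m k i, h m k j, h m j i]
  simp_rw [g.christoffel_symm y _ k i, g.christoffel_symm y _ k j, g.christoffel_symm y _ j i]
  ring

theorem riemannUp_swap (y : EuclideanSpace ℝ (Fin n)) (i j k m : Fin n) :
    g.riemannUp e y i j k m = -g.riemannUp e y j i k m := by
  simp only [riemannUp, Finset.sum_sub_distrib]
  ring

/-- Tracing the first Bianchi identity gives `R_{kl} - R_{lk} + R_{lkm}{}^m = 0`, and the last trace
vanishes by antisymmetry in the last pair. -/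
theorem ricci_symm_of_weyl_eq_zero (he : e ∈ IsManifold.maximalAtlas (𝓡 n) ∞ M)
    {y : EuclideanSpace ℝ (Fin n)} (hy : y ∈ e.target)
    (hW : ∀ j k l m, g.weyl e y j k l m = 0) (k l : Fin n) :
    g.ricci e y k l = g.ricci e y l k := by
  have htr : ∑ m, g.riemannUp e y l k m m = 0 := by
    have h : ∑ m, g.riemannUp e y l k m m = -∑ m, g.riemannUp e y l k m m := by
      simp_rw [g.riemannUp_eq_sum he hy]
      conv_rhs => rw [Finset.sum_comm]
      simp_rw [← Finset.sum_neg_distrib]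
      refine Finset.sum_congr rfl fun m _ => Finset.sum_congr rfl fun p _ => ?_
      rw [g.riemann_antisymm_of_weyl_eq_zero hW l k m p, g.gUp_symm y p m]
      ring
    linarith
  have hb : ∑ m, (g.riemannUp e y k m l m + g.riemannUp e y m l k m + g.riemannUp e y l k m m)
      = 0 := Finset.sum_eq_zero fun m _ => g.riemannUp_bianchi y k m l m
  simp_rw [g.riemannUp_swap y _ l k, Finset.sum_add_distrib, Finset.sum_neg_distrib, htr] at hb
  unfold ricci
  linarith

theorem ricci_eq_sum (he : e ∈ IsManifold.maximalAtlas (𝓡 n) ∞ M)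
    {y : EuclideanSpace ℝ (Fin n)} (hy : y ∈ e.target) (k l : Fin n) :
    g.ricci e y k l = ∑ m, ∑ p, g.riemann e y k m l p * g.gUp e y p m := by
  simp_rw [ricci, g.riemannUp_eq_sum he hy]

theorem sum_gLow_mul_vecUp (he : e ∈ IsManifold.maximalAtlas (𝓡 n) ∞ M)
    {y : EuclideanSpace ℝ (Fin n)} (hy : y ∈ e.target) (X : ∀ x : M, TangentSpace (𝓡 n) x)
    (k : Fin n) : ∑ i, g.gLow e y k i * g.vecUp e X y i = g.vecLow e X y k :=
  (g.vecLow_eq_sum X y (g.eq_sum_vecUp_smul_coordVec he hy X) k).symm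

theorem sum_riemann_mul_vecUp (he : e ∈ IsManifold.maximalAtlas (𝓡 n) ∞ M)
    {y : EuclideanSpace ℝ (Fin n)} (hy : y ∈ e.target) (X : ∀ x : M, TangentSpace (𝓡 n) x)
    (i j k : Fin n) : ∑ m, g.riemann e y i j k m * g.vecUp e X y m =
      ∑ m, g.riemannUp e y i j k m * g.vecLow e X y m := by
  simp_rw [riemann, ← g.sum_gLow_mul_vecUp he hy X, Finset.sum_mul, Finset.mul_sum]
  rw [Finset.sum_comm]
  exact Finset.sum_congr rfl fun _ _ => Finset.sum_congr rfl fun _ _ => mul_assoc _ _ _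

/-! ### Contractions of the curvature with `X`. -/

section Curvature

variable {g} {X : ∀ x : M, TangentSpace (𝓡 n) x} {y : EuclideanSpace ℝ (Fin n)} {a : Fin n → ℝ}

/-- If `R_{ijk}{}^m X_m = a_i g_{jk} - a_j g_{ik}`, then `R_{kl} X^l = -(n - 1) a_k`. -/
theorem ricci_mul_vecUp_of_riemannUp (he : e ∈ IsManifold.maximalAtlas (𝓡 n) ∞ M)
    (hy : y ∈ e.target) (hW : ∀ j k l m, g.weyl e y j k l m = 0)
    (ha : ∀ i j k, ∑ m, g.riemannUp e y i j k m * g.vecLow e X y m =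
      a i * g.gLow e y j k - a j * g.gLow e y i k) (k : Fin n) :
    ∑ l, g.ricci e y k l * g.vecUp e X y l = -((n : ℝ) - 1) * a k := by
  -- Antisymmetry in the last pair moves `X` from the third slot to the fourth, where `ha` applies.
  have h1 : ∑ l, g.ricci e y k l * g.vecUp e X y l = ∑ m, ∑ p,
      -(∑ l, g.riemann e y k m p l * g.vecUp e X y l) * g.gUp e y p m := by
    simp_rw [g.ricci_eq_sum he hy, Finset.sum_mul]
    rw [Finset.sum_comm]
    refine Finset.sum_congr rfl fun m _ => ?_
    rw [Finset.sum_comm]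
    refine Finset.sum_congr rfl fun p _ => ?_
    rw [neg_mul, Finset.sum_mul, ← Finset.sum_neg_distrib]
    refine Finset.sum_congr rfl fun l _ => ?_
    rw [g.riemann_antisymm_of_weyl_eq_zero hW k m l p]
    ring
  have h2 : ∀ m, ∑ p, -(a k * g.gLow e y m p - a m * g.gLow e y k p) * g.gUp e y p m =
      -a k + a m * if k = m then 1 else 0 := by
    intro m
    rw [← g.sum_gLow_mul_gUp he hy k m, Finset.mul_sum]
    have : -a k = ∑ p, -a k * (g.gLow e y m p * g.gUp e y p m) := by
      rw [← Finset.mul_sum, g.sum_gLow_mul_gUp he hy]; simp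
    rw [this, ← Finset.sum_add_distrib]
    exact Finset.sum_congr rfl fun p _ => by ring
  simp_rw [h1, g.sum_riemann_mul_vecUp he hy, ha, h2, Finset.sum_add_distrib]
  simp
  ring

/-- `R_{jklm} X^l X^m` vanishes by antisymmetry, while `ha` evaluates it to `a_j X_k - a_k X_j`. -/
theorem mul_vecLow_comm_of_riemannUp (he : e ∈ IsManifold.maximalAtlas (𝓡 n) ∞ M)
    (hy : y ∈ e.target) (hW : ∀ j k l m, g.weyl e y j k l m = 0)
    (ha : ∀ i j k, ∑ m, g.riemannUp e y i j k m * g.vecLow e X y m =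
      a i * g.gLow e y j k - a j * g.gLow e y i k) (j k : Fin n) :
    a j * g.vecLow e X y k = a k * g.vecLow e X y j := by
  have h1 : ∑ l, (∑ m, g.riemann e y j k l m * g.vecUp e X y m) * g.vecUp e X y l =
      -∑ l, (∑ m, g.riemann e y j k l m * g.vecUp e X y m) * g.vecUp e X y l := by
    simp_rw [Finset.sum_mul]
    conv_rhs => rw [Finset.sum_comm]
    simp_rw [← Finset.sum_neg_distrib]
    refine Finset.sum_congr rfl fun l _ => Finset.sum_congr rfl fun m _ => ?_
    rw [g.riemann_antisymm_of_weyl_eq_zero hW j k l m]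
    ring
  simp_rw [g.sum_riemann_mul_vecUp he hy, ha, sub_mul, Finset.sum_sub_distrib, mul_assoc,
    ← Finset.mul_sum, g.sum_gLow_mul_vecUp he hy] at h1
  linarith

/-- Contract `a_j X_k = a_k X_j` with `X^k` and divide by `X²`. -/
theorem eq_mul_vecLow_of_riemannUp (he : e ∈ IsManifold.maximalAtlas (𝓡 n) ∞ M)
    (hy : y ∈ e.target) (hW : ∀ j k l m, g.weyl e y j k l m = 0)
    (hX : g.normSq X (e.symm y) ≠ 0)
    (ha : ∀ i j k, ∑ m, g.riemannUp e y i j k m * g.vecLow e X y m =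
      a i * g.gLow e y j k - a j * g.gLow e y i k) (j : Fin n) :
    a j = (∑ k, g.vecUp e X y k * a k) / g.normSq X (e.symm y) * g.vecLow e X y j := by
  rw [div_mul_eq_mul_div, eq_div_iff hX, ← g.normSq_eq_sum he hy, Finset.mul_sum, Finset.sum_mul]
  exact Finset.sum_congr rfl fun k _ => by
    linear_combination g.vecUp e X y k * mul_vecLow_comm_of_riemannUp he hy hW ha j k

/-- The perfect fluid form of the Ricci tensor of a Robertson-Walker space-time. -/
theorem ricci_eq_of_riemannUp (hn : 3 ≤ n) (he : e ∈ IsManifold.maximalAtlas (𝓡 n) ∞ M)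
    (hy : y ∈ e.target) (hW : ∀ j k l m, g.weyl e y j k l m = 0)
    (hX : g.normSq X (e.symm y) ≠ 0)
    (ha : ∀ i j k, ∑ m, g.riemannUp e y i j k m * g.vecLow e X y m =
      a i * g.gLow e y j k - a j * g.gLow e y i k) {β : ℝ}
    (hβ : ∀ j, a j = β * g.vecLow e X y j) (k l : Fin n) :
    g.ricci e y k l = (g.scalar e y + ((n : ℝ) - 1) * β) / ((n : ℝ) - 1) * g.gLow e y k l +
      (-n * ((n : ℝ) - 1) * β - g.scalar e y) / ((n : ℝ) - 1) *
        (g.vecLow e X y k * g.vecLow e X y l / g.normSq X (e.symm y)) := by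
  have hn3 : (3 : ℝ) ≤ n := by exact_mod_cast hn
  have hn1 : (n : ℝ) - 1 ≠ 0 := by linarith
  have hn2 : (n : ℝ) - 2 ≠ 0 := by linarith
  have hR : ∀ k, ∑ l, g.ricci e y k l * g.vecUp e X y l =
      -((n : ℝ) - 1) * β * g.vecLow e X y k := fun k => by
    rw [ricci_mul_vecUp_of_riemannUp he hy hW ha, hβ]; ring
  have hR' : ∀ k, ∑ l, g.ricci e y l k * g.vecUp e X y l =
      -((n : ℝ) - 1) * β * g.vecLow e X y k := fun k => by
    simp_rw [← hR k, g.ricci_symm_of_weyl_eq_zero he hy hW k]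
  have hG := g.sum_gLow_mul_vecUp he hy X
  have hG' : ∀ k, ∑ i, g.gLow e y i k * g.vecUp e X y i = g.vecLow e X y k := fun k => by
    simp_rw [← hG k, g.gLow_symm y k]
  have hN : ∑ i, g.vecLow e X y i * g.vecUp e X y i = g.normSq X (e.symm y) := by
    rw [← g.normSq_eq_sum he hy]; exact Finset.sum_congr rfl fun _ _ => mul_comm _ _
  -- This is `C_{jklm} X^m = 0` with every contraction evaluated.
  have h1 : ∀ j, β * (g.vecLow e X y j * g.gLow e y k l - g.vecLow e X y k * g.gLow e y j l) +
      1 / ((n : ℝ) - 2) * (g.vecLow e X y j * g.ricci e y k l - g.vecLow e X y k * g.ricci e y j l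
        + -((n : ℝ) - 1) * β * g.vecLow e X y j * g.gLow e y k l
        - -((n : ℝ) - 1) * β * g.vecLow e X y k * g.gLow e y j l)
      - g.scalar e y / (((n : ℝ) - 1) * ((n : ℝ) - 2)) *
        (g.vecLow e X y j * g.gLow e y k l - g.gLow e y j l * g.vecLow e X y k) = 0 := by
    intro j
    have hc : ∑ m, g.weyl e y j k l m * g.vecUp e X y m = 0 := by simp [hW]
    have hrm := (g.sum_riemann_mul_vecUp he hy X j k l).trans (ha j k l)
    rw [hβ j, hβ k] at hrm
    have h2 : ∑ m, g.weyl e y j k l m * g.vecUp e X y m =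
        ∑ m, g.riemann e y j k l m * g.vecUp e X y m + 1 / ((n : ℝ) - 2) *
        ((∑ m, g.gLow e y j m * g.vecUp e X y m) * g.ricci e y k l
          - (∑ m, g.gLow e y k m * g.vecUp e X y m) * g.ricci e y j l
          + (∑ m, g.ricci e y j m * g.vecUp e X y m) * g.gLow e y k l
          - (∑ m, g.ricci e y k m * g.vecUp e X y m) * g.gLow e y j l)
        - g.scalar e y / (((n : ℝ) - 1) * ((n : ℝ) - 2)) *
          ((∑ m, g.gLow e y j m * g.vecUp e X y m) * g.gLow e y k l
            - g.gLow e y j l * ∑ m, g.gLow e y k m * g.vecUp e X y m) := by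
      simp only [Finset.sum_mul, Finset.mul_sum, ← Finset.sum_add_distrib,
        ← Finset.sum_sub_distrib]
      exact Finset.sum_congr rfl fun m _ => by rw [weyl]; ring
    rw [hc, hrm, hG, hG, hR, hR] at h2
    linear_combination -h2
  -- A second contraction, with `X^j`: now `R_{kl}` appears only with the nonzero coefficient `X² /
  -- (n-2)`. The term `R_{jl} X^j` is where the symmetry of Ricci enters, through `hR'`.
  have h3 : ∑ j, (β * (g.vecLow e X y j * g.gLow e y k l - g.vecLow e X y k * g.gLow e y j l) +
      1 / ((n : ℝ) - 2) * (g.vecLow e X y j * g.ricci e y k l - g.vecLow e X y k * g.ricci e y j l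
        + -((n : ℝ) - 1) * β * g.vecLow e X y j * g.gLow e y k l
        - -((n : ℝ) - 1) * β * g.vecLow e X y k * g.gLow e y j l)
      - g.scalar e y / (((n : ℝ) - 1) * ((n : ℝ) - 2)) *
        (g.vecLow e X y j * g.gLow e y k l - g.gLow e y j l * g.vecLow e X y k)) *
        g.vecUp e X y j =
      β * ((∑ j, g.vecLow e X y j * g.vecUp e X y j) * g.gLow e y k l
        - g.vecLow e X y k * ∑ j, g.gLow e y j l * g.vecUp e X y j) +
      1 / ((n : ℝ) - 2) * ((∑ j, g.vecLow e X y j * g.vecUp e X y j) * g.ricci e y k l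
        - g.vecLow e X y k * ∑ j, g.ricci e y j l * g.vecUp e X y j
        + -((n : ℝ) - 1) * β * (∑ j, g.vecLow e X y j * g.vecUp e X y j) * g.gLow e y k l
        - -((n : ℝ) - 1) * β * g.vecLow e X y k * ∑ j, g.gLow e y j l * g.vecUp e X y j)
      - g.scalar e y / (((n : ℝ) - 1) * ((n : ℝ) - 2)) *
        ((∑ j, g.vecLow e X y j * g.vecUp e X y j) * g.gLow e y k l
          - (∑ j, g.gLow e y j l * g.vecUp e X y j) * g.vecLow e X y k) := by
    simp only [Finset.sum_mul, Finset.mul_sum, ← Finset.sum_add_distrib,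
      ← Finset.sum_sub_distrib]
    exact Finset.sum_congr rfl fun j _ => by ring
  simp only [h1, zero_mul, Finset.sum_const_zero, hN, hG', hR'] at h3
  field_simp at h3 ⊢
  linear_combination -h3

end Curvature

end LorentzMetric

/-! ### The curvature of a Robertson–Walker space-time. -/

theorem mainTheorem7 {n : ℕ} (hn : 3 ≤ n) {M : Type*} [TopologicalSpace M]
    [ChartedSpace (EuclideanSpace ℝ (Fin n)) M] [IsManifold (𝓡 n) ∞ M]
    (g : LorentzMetric n M) (X : ∀ x : M, TangentSpace (𝓡 n) x)
    (hX : g.IsChenVector X) (hC : g.WeylFlat) :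
    ∃ ξ : M → ℝ, ∀ e ∈ IsManifold.maximalAtlas (𝓡 n) ∞ M, ∀ y ∈ e.target,
      (∀ j : Fin n,
        ∑ m, g.ricci e y j m * g.vecUp e X y m = ξ (e.symm y) * g.vecLow e X y j) ∧
      ∀ j k l m : Fin n,
        g.riemann e y j k l m =
          (2 * ξ (e.symm y) - g.scalar e y) / (((n : ℝ) - 1) * ((n : ℝ) - 2)) *
            (g.gLow e y k l * g.gLow e y j m - g.gLow e y k m * g.gLow e y j l) +
          (g.scalar e y - n * ξ (e.symm y)) / (((n : ℝ) - 1) * ((n : ℝ) - 2)) *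
            (g.gLow e y j m * (g.vecLow e X y k * g.vecLow e X y l / g.normSq X (e.symm y))
              - g.gLow e y k m * (g.vecLow e X y j * g.vecLow e X y l / g.normSq X (e.symm y))
              + g.gLow e y k l * (g.vecLow e X y j * g.vecLow e X y m / g.normSq X (e.symm y))
              - g.gLow e y j l * (g.vecLow e X y k * g.vecLow e X y m / g.normSq X (e.symm y))) :=
  by
  obtain ⟨ρ, hρ⟩ := hX.concircular
  -- `mfderiv` would default to zero at a point where `ρ` is not differentiable; `hdiff` below rules
  -- this out.
  let D : M → ℝ := fun x => mfderiv (𝓡 n) 𝓘(ℝ, ℝ) ρ x (X x)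
  -- This is `ξ = -(n-1) β` with `β = dρ(X) / X²`.
  refine ⟨fun x => -((n : ℝ) - 1) * (D x / g.normSq X x), fun e he y hy => ?_⟩
  have hn0 : n ≠ 0 := by omega
  have hW := hC e he y hy
  have hN := (hX.timelike (e.symm y)).ne
  have ha := g.sum_riemannUp_mul_vecLow hn0 he hX.contMDiff (hρ e he) hy
  have hdiff : DifferentiableAt ℝ (fun z => ρ (e.symm z)) y :=
    ((g.contDiffOn_of_nablaLow_eq hn0 he hX.contMDiff (hρ e he)).contDiffAt
      (e.open_target.mem_nhds hy)).differentiableAt (by simp)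
  have hD : ∑ k, g.vecUp e X y k * partialD k (fun z => ρ (e.symm z)) y = D (e.symm y) := by
    change _ = mfderiv (𝓡 n) 𝓘(ℝ, ℝ) ρ (e.symm y) (X (e.symm y))
    rw [g.eq_sum_vecUp_smul_coordVec he hy X, map_sum]
    refine Finset.sum_congr rfl fun k _ => ?_
    rw [map_smul, LorentzMetric.partialD_comp_symm he hy hdiff]
    rfl
  have hβ := LorentzMetric.eq_mul_vecLow_of_riemannUp he hy hW hN ha
  rw [hD] at hβ
  refine ⟨fun j => ?_, fun j k l m => ?_⟩
  · rw [LorentzMetric.ricci_mul_vecUp_of_riemannUp he hy hW ha, hβ, mul_assoc]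
  · have hRic := LorentzMetric.ricci_eq_of_riemannUp hn he hy hW hN ha hβ
    have h := hW j k l m
    have hn3 : (3 : ℝ) ≤ n := by exact_mod_cast hn
    have hn1 : (n : ℝ) - 1 ≠ 0 := by linarith
    have hn2 : (n : ℝ) - 2 ≠ 0 := by linarith
    rw [LorentzMetric.weyl, hRic k l, hRic j l, hRic j m, hRic k m] at h
    field_simp at h ⊢
    linear_combination h
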